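/- Consider a target $x(k+1)=Ax(k)+w(k)$ in $\mathbb{R}^n$, $w(k)\sim\mathcal N(0,Q)$, observed by $N$ sensor nodes $z_i(k)=H_ix(k)+v_i(k)$, $v_i(k)\sim\mathcal N(0,R_i)$, with $Q\succ0$ and $R_i\succ0$, and assume network observability: the pair $(A,[H_1^T,\dots,H_N^T]^T)$ is observable. Let $\mathcal N_i(k)$ be the set of nodes $j$ whose broadcast reaches node $i$ at instant $k$ (that is, $j$ is linked to $i$ at instant $k$ and the triggering function of $j$ fires), let $G(k)$ be the directed graph with edges $(i,j)$, $j\in\mathcal N_i(k)$, and put $\mathcal J_i(k)=\mathcal N_i(k)\cup\{i\}$. Put $U_j=H_j^TR_j^{-1}H_j$ and $u_j(k)=H_j^TR_j^{-1}z_j(k)$. The filter ECO-DKF starts from positive definite matrices $\hat P_i^*(0)$ and estimates $\hat x_i^*(0)$. At each instant $k\ge1$, node $i$ predicts $$\bar P_i=A\hat P_i^*(k-1)A^T+Q,\qquad \bar x_i=A\hat x_i^*(k-1),\qquad \bar S_i=\bar P_i^{-1},\qquad \bar s_i=\bar S_i\bar x_i,$$ and takes a solution $(\bar S_i^*,\lambda_i^*)$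 of the outer Löwner–John problem $$\min_{\bar S,\lambda}\ \operatorname{Tr}(\bar S^{-1})\quad\text{s.t.}\quad 0\prec\bar S\preceq\sum_{j\in\mathcal J_i}\lambda_j\bar S_j,\quad \sum_{j\in\mathcal J_i}\lambda_j\le1,\quad \lambda_j\ge0.$$ With $\bar x_i^*=(\bar S_i^*)^{-1}\sum_{j\in\mathcal J_i}\lambda_{ij}^*\bar s_j$, $Y_i=\sum_{j\in\mathcal J_i}U_j$ and $y_i=\sum_{j\in\mathcal J_i}u_j$, it then sets $$\hat P_i^*(k)=(\bar S_i^*+Y_i)^{-1},\qquad \hat x_i^*(k)=\bar x_i^*+\hat P_i^*(k)\,(y_i-Y_i\bar x_i^*).$$ Whether node $i$ broadcasts at instant $k$ is decided by an event-triggering rule depending on $\lambda_i^*(k-1)$, $\mathcal J_i(k-1)$ and $k$, for example: broadcast if and only if the largest entry of $\lambda_i^*(k-1)$ is $\lambda_{ii}^*(k-1)$, or $\mathcal J_i(k-1)=\{i\}$ and a Bernoulli draw succeeds. Theorem. Suppose that the (time-varying) graph sequence $G(k)$ is periodically jointly connected with some finite period $t\in\mathbb N$: for every $k\ge1$, the union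 $\bigcup_{s=0}^{t}G(k+s)$ is strongly connected. Then ECO-DKF is globally asymptotically stable: the origin of the noiseless ($w=0$, $v_i=0$) dynamics of the stacked estimation error $\eta=(\eta_1,\dots,\eta_N)$, $\eta_i(k)=\hat x_i^*(k)-x(k)$, is Lyapunov stable and globally attractive, uniformly in the initial instant. This holds for every choice of the link graphs, of the triggering rule, of the matrices $\hat P_i^*(0)\succ0$, and of the solutions of the optimisation problems. -/

import Mathlib

open Matrix Filter Topology

noncomputable section

namespace ECODKF

/-- Observability of the pair `(A, C)`: the observability matrix with block rows
`C, C A, …, C A ^ (n - 1)` has full column rank `n`. -/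
def Observable {n : ℕ} {p : Type*} (A : Matrix (Fin n) (Fin n) ℝ)
    (C : Matrix p (Fin n) ℝ) : Prop :=
  (Matrix.of fun (r : Fin n × p) (c : Fin n) => (C * A ^ (r.1 : ℕ)) r.2 c).rank = n

/-- The linear target system `x(k+1) = A x(k) + w(k)`, `w ~ N(0, Q)`, together with the linear
sensors `z_i(k) = H_i x(k) + v_i(k)`, `v_i ~ N(0, R_i)`, of the nodes `i : V`. The output
dimension `m i` may differ from node to node. -/
structure SensorNetwork (V : Type*) (n : ℕ) where
  A : Matrix (Fin n) (Fin n) ℝ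
  Q : Matrix (Fin n) (Fin n) ℝ
  m : V → ℕ
  H : (i : V) → Matrix (Fin (m i)) (Fin n) ℝ
  R : (i : V) → Matrix (Fin (m i)) (Fin (m i)) ℝ
  Q_posDef : Q.PosDef
  R_posDef : ∀ i, (R i).PosDef

section Graphs

variable {V : Type*}

/-- Strong connectivity: every node is joined to every node by a directed path. -/
def StronglyConnected (G : Digraph V) : Prop :=
  ∀ i j, Relation.ReflTransGen G.Adj i j

/-- Periodic joint connectivity with period `t` at instant `k`: the union of
`G k, G (k + 1), …, G (k + t)` is strongly connected. -/
def IsPJC (G : ℕ → Digraph V) (t k : ℕ) : Prop :=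
  StronglyConnected (⨆ s : Fin (t + 1), G (k + s))

/-- The communication graph at one instant: node `i` receives the message of node `j` if `j` is
linked to `i` and `j` broadcasts. -/
def commGraph (link : Digraph V) (bcast : V → Prop) : Digraph V where
  Adj i j := link.Adj i j ∧ bcast j

open Classical in
/-- `J_i = N_i ∪ {i}`, where `N_i = {j | (i, j) ∈ E}`: node `i` and the nodes it hears. -/
def hood [Fintype V] (G : Digraph V) (i : V) : Finset V :=
  Finset.univ.filter fun j => j = i ∨ G.Adj i j

/-- A family of triggering functions. `g i k J lam` says that node `i` broadcasts at instant `k`,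
where `J` and `lam` are the set `J_i` and the weights `lam_i*` at node `i` at instant `k - 1`.
The rule "broadcast iff the largest weight is the node's own weight, or the node is isolated and
a Bernoulli draw succeeds" is, for each realisation `b` of the draws, the instance
`fun i k J lam => (∀ j ∈ J, lam j ≤ lam i) ∨ (J = {i} ∧ b i k)`. -/
abbrev Trigger (V : Type*) := V → ℕ → Finset V → (V → ℝ) → Prop

end Graphs

section OuterLJ

variable {V : Type*} {n : ℕ}

/-- Feasible points of the outer Löwner–John problem for the matrices `Sbar j`, `j ∈ J`:
`0 ≺ S ⪯ ∑ lam_j Sbar_j`, `∑ lam_j ≤ 1`, `lam_j ≥ 0`. -/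
def LJFeasible (J : Finset V) (Sbar : V → Matrix (Fin n) (Fin n) ℝ)
    (S : Matrix (Fin n) (Fin n) ℝ) (lam : V → ℝ) : Prop :=
  S.PosDef ∧ (∑ j ∈ J, lam j • Sbar j - S).PosSemidef ∧
    ∑ j ∈ J, lam j ≤ 1 ∧ ∀ j ∈ J, 0 ≤ lam j

/-- `(S, lam)` solves the outer Löwner–John problem: it minimises `Tr (S⁻¹)` among the feasible
points. -/
def LJOptimal (J : Finset V) (Sbar : V → Matrix (Fin n) (Fin n) ℝ)
    (S : Matrix (Fin n) (Fin n) ℝ) (lam : V → ℝ) : Prop :=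
  LJFeasible J Sbar S lam ∧
    ∀ S' lam', LJFeasible J Sbar S' lam' → (S⁻¹).trace ≤ (S'⁻¹).trace

end OuterLJ

namespace SensorNetwork

variable {V : Type*} {n : ℕ} (M : SensorNetwork V n)

/-- The stacked output matrix `[H_1ᵀ, …, H_Nᵀ]ᵀ`. -/
def stackedH : Matrix (Σ i, Fin (M.m i)) (Fin n) ℝ :=
  Matrix.of fun r c => M.H r.1 r.2 c

/-- Network observability. -/
def NetworkObservable : Prop := Observable M.A M.stackedH

/-- `P̄ = A P̂ Aᵀ + Q`. -/
def predCov (P : Matrix (Fin n) (Fin n) ℝ) : Matrix (Fin n) (Fin n) ℝ :=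
  M.A * P * M.Aᵀ + M.Q

/-- `U_i = H_iᵀ R_i⁻¹ H_i`. -/
def U (i : V) : Matrix (Fin n) (Fin n) ℝ := (M.H i)ᵀ * (M.R i)⁻¹ * M.H i

/-- `u_i = H_iᵀ R_i⁻¹ z_i`. -/
def u (i : V) (z : Fin (M.m i) → ℝ) : Fin n → ℝ := ((M.H i)ᵀ * (M.R i)⁻¹) *ᵥ z

end SensorNetwork

variable {V : Type*} [Fintype V] {n : ℕ}

/-- A run of the covariance, weight and broadcast part of the filter, for the link graphs
`link k` and the triggering functions `g`. (This part does not involve the measured data.)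
All quantities at instants `k ≥ 1` are produced by the algorithm; those at instant `0` are its
initialisation, which may differ from node to node. Whenever the outer Löwner–John problem has
several solutions, any of them may be taken. -/
structure Run (M : SensorNetwork V n) (link : ℕ → Digraph V) (g : Trigger V) where
  /-- `bcast k i`: node `i` broadcasts at instant `k`. -/
  bcast : ℕ → V → Prop
  /-- `P̂_i*(k)`, the covariance matrices after correction. -/
  Phat : ℕ → V → Matrix (Fin n) (Fin n) ℝ
  /-- `S̄_i*(k)`, the fused predicted information matrices. -/
  Sstar : ℕ → V → Matrix (Fin n) (Fin n) ℝ
  /-- `lam k i j` is the weight `lam_ij*(k)` that node `i` gives to node `j`. -/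
  lam : ℕ → V → V → ℝ
  Phat_zero : ∀ i, (Phat 0 i).PosDef
  bcast_succ : ∀ k i, bcast (k + 1) i ↔
    g i (k + 1) (hood (commGraph (link k) (bcast k)) i) (lam k i)
  fusion : ∀ k i, LJOptimal (hood (commGraph (link (k + 1)) (bcast (k + 1))) i)
    (fun j => (M.predCov (Phat k j))⁻¹) (Sstar (k + 1) i) (lam (k + 1) i)
  correction : ∀ k i, Phat (k + 1) i =
    (Sstar (k + 1) i +
      ∑ j ∈ hood (commGraph (link (k + 1)) (bcast (k + 1))) i, M.U j)⁻¹

namespace Run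

variable {M : SensorNetwork V n} {link : ℕ → Digraph V} {g : Trigger V} (ρ : Run M link g)

/-- The communication graph `G(k)` of the run. -/
def graph (k : ℕ) : Digraph V := commGraph (link k) (ρ.bcast k)

/-- `J_i(k)`. -/
def J (k : ℕ) (i : V) : Finset V := hood (ρ.graph k) i

/-- `Y_i(k) = ∑_{j ∈ J_i(k)} U_j`. -/
def Y (k : ℕ) (i : V) : Matrix (Fin n) (Fin n) ℝ := ∑ j ∈ ρ.J k i, M.U j

/-- `y_i(k) = ∑_{j ∈ J_i(k)} u_j(k)`. -/
def y (k : ℕ) (z : (j : V) → Fin (M.m j) → ℝ) (i : V) : Fin n → ℝ :=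
  ∑ j ∈ ρ.J k i, M.u j (z j)

/-- The fused prediction `x̄_i*(k+1) = (S̄_i*)⁻¹ ∑_{j ∈ J_i} lam_ij* s̄_j`, where
`s̄_j = P̄_j⁻¹ x̄_j` and `x̄_j = A x̂_j*(k)`. -/
def xbarStar (k : ℕ) (xhat : V → Fin n → ℝ) (i : V) : Fin n → ℝ :=
  (ρ.Sstar (k + 1) i)⁻¹ *ᵥ
    ∑ j ∈ ρ.J (k + 1) i, ρ.lam (k + 1) i j •
      ((M.predCov (ρ.Phat k j))⁻¹ *ᵥ (M.A *ᵥ xhat j))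

/-- The estimates at instant `k + 1` computed from the estimates `xhat` at instant `k` and the
measurements `z` at instant `k + 1`: `x̂_i* = x̄_i* + P̂_i* (y_i - Y_i x̄_i*)`. -/
def nextEstimate (k : ℕ) (xhat : V → Fin n → ℝ) (z : (j : V) → Fin (M.m j) → ℝ) (i : V) :
    Fin n → ℝ :=
  ρ.xbarStar k xhat i +
    ρ.Phat (k + 1) i *ᵥ (ρ.y (k + 1) z i - ρ.Y (k + 1) i *ᵥ ρ.xbarStar k xhat i)

/-- `x` and `xhat` are trajectories, from instant `k₀` on, of the target and of the estimates
when there is no noise (`w = 0` and `v_i = 0`). -/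
def IsNoiselessTrajectory (k₀ : ℕ) (x : ℕ → Fin n → ℝ) (xhat : ℕ → V → Fin n → ℝ) : Prop :=
  ∀ k, k₀ ≤ k → x (k + 1) = M.A *ᵥ x k ∧
    ∀ i, xhat (k + 1) i = ρ.nextEstimate k (xhat k) (fun j => M.H j *ᵥ x (k + 1)) i

/-- `η` is a trajectory, from instant `k₀` on, of the stacked noiseless estimation error
`η_i = x̂_i - x`. -/
def IsErrorTrajectory (k₀ : ℕ) (η : ℕ → V → Fin n → ℝ) : Prop :=
  ∃ x xhat, ρ.IsNoiselessTrajectory k₀ x xhat ∧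
    ∀ k, k₀ ≤ k → ∀ i, η k i = xhat k i - x k

/-- Global asymptotic stability of the estimator, i.e. of the origin for the time-varying
noiseless error dynamics: Lyapunov stability and global attractivity, both uniform in the
initial instant `k₀`. (The norm is the maximum norm; in finite dimension the choice is
immaterial.) -/
def GloballyAsymptoticallyStable : Prop :=
  (∀ ε > 0, ∃ δ > 0, ∀ k₀ η, ρ.IsErrorTrajectory k₀ η → ‖η k₀‖ < δ →
      ∀ k, k₀ ≤ k → ‖η k‖ < ε) ∧
    (∀ r > 0, ∀ ε > 0, ∃ T : ℕ, ∀ k₀ η, ρ.IsErrorTrajectory k₀ η → ‖η k₀‖ < r →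
      ∀ k, k₀ + T ≤ k → ‖η k‖ < ε)

end Run

end ECODKF

end

/-! Write `P_i` for `ρ.Phat k i`. The Lyapunov function is the largest of the forms `η_iᵀ P_i⁻¹
η_i`. At an optimum the fused information matrix equals the weighted sum (`LJOptimal.eq_sum`), so
the true state cancels and `P_i⁻¹ η_i` becomes a weighted sum of the predicted terms. With weights
of sum at most one, the Lyapunov function shrinks by a factor `β < 1` at each instant, provided that
the covariances are bounded: then `A P Aᵀ ⪯ δ Q` with a fixed `δ`, and prediction contracts the
information form. The information matrices are bounded through `Q⁻¹` and the `U_j`, so the decay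
carries over to the norm.

The main difficulty is the bound on the covariances (`exists_trace_Phat_le`). First-order optimality
yields `(wᵀ S⁻¹ w)² ≤ |w|² tr(S⁻¹) wᵀ P̄_j w` for every node `j` that is heard. Hence, if all traces
are at most `μ` and the predicted variance of `w` at `j` is `o(μ)`, then so is its variance at the
listener, whatever the weights. If the covariances were unbounded, there would be windows of a fixed
length `K`, with thresholds `μ → ∞`, in which the traces stay below `μ` until one exceeds it at the
end. Along an ultrafilter, the functionals of variance `o(μ)` form subspaces that contain the
measured ones and spread along the communication edges. Joint connectivity and observability make
them the whole space at every node after `K` steps, so the final traces are `o(μ)`, a contradiction.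
-/

namespace ECODKF

/-! ### Inequalities for quadratic forms, inverses and traces. -/

section QuadraticForms

variable {ι κ : Type*} [Fintype ι] [Fintype κ]

theorem dotProduct_mulVec_symm {S : Matrix ι ι ℝ} (hS : S.IsHermitian) (x y : ι → ℝ) :
    x ⬝ᵥ S *ᵥ y = y ⬝ᵥ S *ᵥ x := by
  have h : Sᵀ = S := by simpa using hS.eq
  rw [dotProduct_mulVec, dotProduct_comm, ← mulVec_transpose, h]

theorem dotProduct_congr_mulVec (A : Matrix κ ι ℝ) (P : Matrix ι ι ℝ) (w : κ → ℝ) :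
    w ⬝ᵥ (A * P * Aᵀ) *ᵥ w = (Aᵀ *ᵥ w) ⬝ᵥ P *ᵥ (Aᵀ *ᵥ w) := by
  rw [← mulVec_mulVec, ← mulVec_mulVec, dotProduct_mulVec, ← mulVec_transpose]

theorem posSemidef_nonneg {S : Matrix ι ι ℝ} (hS : S.PosSemidef) (x : ι → ℝ) :
    0 ≤ x ⬝ᵥ S *ᵥ x := by
  simpa using hS.dotProduct_mulVec_nonneg x

theorem dotProduct_self_nonneg (x : ι → ℝ) : 0 ≤ x ⬝ᵥ x :=
  Finset.sum_nonneg fun i _ => mul_self_nonneg (x i)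

theorem sq_dotProduct_le (x y : ι → ℝ) : (x ⬝ᵥ y) ^ 2 ≤ (x ⬝ᵥ x) * (y ⬝ᵥ y) := by
  simpa [dotProduct, pow_two] using Finset.sum_mul_sq_le_sq_mul_sq Finset.univ x y

theorem form_sum_smul {ν : Type*} (J : Finset ν) (c : ν → ℝ) (S : ν → Matrix ι ι ℝ) (x y : ι → ℝ) :
    x ⬝ᵥ (∑ j ∈ J, c j • S j) *ᵥ y = ∑ j ∈ J, c j * (x ⬝ᵥ S j *ᵥ y) := by
  simp [sum_mulVec, dotProduct_sum, smul_mulVec, dotProduct_smul]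

/-- A positive semidefinite form is at most its trace times the squared Euclidean norm. -/
theorem form_le_trace_mul [DecidableEq ι] {P : Matrix ι ι ℝ} (hP : P.PosSemidef) (x : ι → ℝ) :
    x ⬝ᵥ P *ᵥ x ≤ P.trace * (x ⬝ᵥ x) := by
  open scoped MatrixOrder in
  obtain ⟨B, rfl⟩ := CStarAlgebra.nonneg_iff_eq_star_mul_self.mp hP.nonneg
  have h1 : x ⬝ᵥ (star B * B) *ᵥ x = ∑ i, (B i ⬝ᵥ x) ^ 2 := by
    rw [star_eq_conjTranspose, conjTranspose_eq_transpose_of_trivial, ← mulVec_mulVec,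
      dotProduct_mulVec, vecMul_transpose]
    exact Finset.sum_congr rfl fun i _ => (pow_two _).symm
  have h2 : (star B * B).trace = ∑ i, B i ⬝ᵥ B i := by
    rw [star_eq_conjTranspose, conjTranspose_eq_transpose_of_trivial, trace_mul_comm]
    rfl
  rw [h1, h2, Finset.sum_mul]
  exact Finset.sum_le_sum fun i _ => sq_dotProduct_le _ _

theorem posDef_congr_add {Q : Matrix κ κ ℝ} (hQ : Q.PosDef) {P : Matrix ι ι ℝ}
    (hP : P.PosSemidef) (A : Matrix κ ι ℝ) : (A * P * Aᵀ + Q).PosDef := by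
  have := hP.mul_mul_conjTranspose_same A
  rw [conjTranspose_eq_transpose_of_trivial] at this
  exact PosDef.posSemidef_add this hQ

theorem posDef_of_posSemidef_sub {ν : Type*} {S T : Matrix ν ν ℝ} (hS : S.PosDef)
    (h : (T - S).PosSemidef) : T.PosDef := by
  simpa using PosDef.add_posSemidef hS h

section Inverse

variable [DecidableEq ι]

theorem mulVec_inv_mulVec {S : Matrix ι ι ℝ} (hS : S.PosDef) (v : ι → ℝ) :
    S *ᵥ (S⁻¹ *ᵥ v) = v := by
  rw [mulVec_mulVec, mul_nonsing_inv _ ((isUnit_iff_isUnit_det _).1 hS.isUnit), one_mulVec]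

theorem inv_mulVec_mulVec {S : Matrix ι ι ℝ} (hS : S.PosDef) (v : ι → ℝ) :
    S⁻¹ *ᵥ (S *ᵥ v) = v := by
  rw [mulVec_mulVec, nonsing_inv_mul _ ((isUnit_iff_isUnit_det _).1 hS.isUnit), one_mulVec]

theorem posDef_inv_inv {S : Matrix ι ι ℝ} (hS : S.PosDef) : S⁻¹⁻¹ = S :=
  nonsing_inv_nonsing_inv _ ((isUnit_iff_isUnit_det _).1 hS.isUnit)

/-- The Fenchel–Young inequality for a positive definite form. -/
theorem two_mul_dotProduct_le {S : Matrix ι ι ℝ} (hS : S.PosDef) (x v : ι → ℝ) :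
    2 * (x ⬝ᵥ v) ≤ x ⬝ᵥ S *ᵥ x + v ⬝ᵥ S⁻¹ *ᵥ v := by
  have h := posSemidef_nonneg hS.posSemidef (x - S⁻¹ *ᵥ v)
  rw [mulVec_sub, mulVec_inv_mulVec hS, dotProduct_sub, sub_dotProduct, sub_dotProduct,
    dotProduct_mulVec_symm hS.isHermitian (S⁻¹ *ᵥ v) x, mulVec_inv_mulVec hS,
    dotProduct_comm (S⁻¹ *ᵥ v) v] at h
  linarith

theorem two_mul_dotProduct_le_weighted {S : Matrix ι ι ℝ} (hS : S.PosDef) (x v : ι → ℝ) {b : ℝ}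
    (hb : 0 < b) : 2 * (x ⬝ᵥ v) ≤ b * (x ⬝ᵥ S *ᵥ x) + b⁻¹ * (v ⬝ᵥ S⁻¹ *ᵥ v) := by
  have h := two_mul_dotProduct_le hS (b • x) v
  simp only [smul_dotProduct, mulVec_smul, dotProduct_smul, smul_eq_mul] at h
  have h2 : b⁻¹ * (2 * (b * (x ⬝ᵥ v))) ≤
      b⁻¹ * (b * (b * (x ⬝ᵥ S *ᵥ x)) + v ⬝ᵥ S⁻¹ *ᵥ v) :=
    mul_le_mul_of_nonneg_left h (inv_nonneg.2 hb.le)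
  have e1 : b⁻¹ * (2 * (b * (x ⬝ᵥ v))) = 2 * (x ⬝ᵥ v) := by field_simp
  have e2 : b⁻¹ * (b * (b * (x ⬝ᵥ S *ᵥ x)) + v ⬝ᵥ S⁻¹ *ᵥ v) =
    b * (x ⬝ᵥ S *ᵥ x) + b⁻¹ * (v ⬝ᵥ S⁻¹ *ᵥ v) := by field_simp
  rwa [e1, e2] at h2

/-- Inversion is antitone on positive definite forms. -/
theorem form_inv_anti {S T : Matrix ι ι ℝ} (hS : S.PosDef) (hT : T.PosDef)
    (h : ∀ x, x ⬝ᵥ S *ᵥ x ≤ x ⬝ᵥ T *ᵥ x) (v : ι → ℝ) :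
    v ⬝ᵥ T⁻¹ *ᵥ v ≤ v ⬝ᵥ S⁻¹ *ᵥ v := by
  have h1 := two_mul_dotProduct_le hS (T⁻¹ *ᵥ v) v
  have h2 := h (T⁻¹ *ᵥ v)
  rw [mulVec_inv_mulVec hT] at h2
  rw [dotProduct_comm v]
  linarith

theorem sq_dotProduct_le_form_mul {S : Matrix ι ι ℝ} (hS : S.PosDef) (x v : ι → ℝ) :
    (x ⬝ᵥ v) ^ 2 ≤ (x ⬝ᵥ S *ᵥ x) * (v ⬝ᵥ S⁻¹ *ᵥ v) := by
  have h (c : ℝ) : 0 ≤ (x ⬝ᵥ S *ᵥ x) * (c * c) + (-2 * (x ⬝ᵥ v)) * c + v ⬝ᵥ S⁻¹ *ᵥ v := by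
    have h := two_mul_dotProduct_le hS (c • x) v
    simp only [smul_dotProduct, mulVec_smul, dotProduct_smul, smul_eq_mul] at h
    linarith
  have := discrim_le_zero h
  rw [discrim] at this
  linarith

theorem trace_eq_sum_form (P : Matrix ι ι ℝ) :
    P.trace = ∑ d, Pi.single d (1 : ℝ) ⬝ᵥ P *ᵥ Pi.single d 1 := by
  simp [trace]

theorem trace_le_of_form_le {P Q : Matrix ι ι ℝ} (h : ∀ x, x ⬝ᵥ P *ᵥ x ≤ x ⬝ᵥ Q *ᵥ x) :
    P.trace ≤ Q.trace := by
  rw [trace_eq_sum_form, trace_eq_sum_form]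
  exact Finset.sum_le_sum fun d _ => h _

theorem trace_congr_le (A : Matrix κ ι ℝ) [DecidableEq κ] {P : Matrix ι ι ℝ}
    (hP : P.PosSemidef) : (A * P * Aᵀ).trace ≤ P.trace * (A * Aᵀ).trace := by
  rw [trace_eq_sum_form, trace_eq_sum_form (A * Aᵀ), Finset.mul_sum]
  refine Finset.sum_le_sum fun d _ => ?_
  rw [dotProduct_congr_mulVec]
  refine (form_le_trace_mul hP _).trans_eq ?_
  rw [← mulVec_mulVec, dotProduct_mulVec _ A, ← mulVec_transpose]

/-- The covariance after a correction with a measurement `H x + v`, `v ~ N(0, R)`, is at most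
`R` on the measured functionals. -/
theorem form_inv_le_of_measured [DecidableEq κ] {Ω : Matrix ι ι ℝ} (hΩ : Ω.PosDef)
    {R : Matrix κ κ ℝ} (hR : R.PosDef) (H : Matrix κ ι ℝ)
    (h : ∀ x, x ⬝ᵥ (Hᵀ * R⁻¹ * H) *ᵥ x ≤ x ⬝ᵥ Ω *ᵥ x) (y : κ → ℝ) :
    (Hᵀ *ᵥ y) ⬝ᵥ Ω⁻¹ *ᵥ (Hᵀ *ᵥ y) ≤ y ⬝ᵥ R *ᵥ y := by
  set x := Ω⁻¹ *ᵥ (Hᵀ *ᵥ y) with hx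
  have h1 := h x
  have h2 := dotProduct_congr_mulVec Hᵀ R⁻¹ x
  rw [transpose_transpose] at h2
  have h3 : x ⬝ᵥ Ω *ᵥ x = (Hᵀ *ᵥ y) ⬝ᵥ x := by
    rw [hx, mulVec_inv_mulVec hΩ, dotProduct_comm]
  have h4 : (Hᵀ *ᵥ y) ⬝ᵥ x = y ⬝ᵥ H *ᵥ x := by
    rw [mulVec_transpose, ← dotProduct_mulVec]
  have h5 := two_mul_dotProduct_le hR y (H *ᵥ x)
  linarith

end Inverse

end QuadraticForms

/-! ### Optimality conditions of the outer Löwner–John problem. -/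

section OuterLJ

variable {V : Type*} {n : ℕ} {J : Finset V} {Sbar : V → Matrix (Fin n) (Fin n) ℝ}
  {S : Matrix (Fin n) (Fin n) ℝ} {lam : V → ℝ}

/-- The fused information matrix is the full convex combination. -/
theorem LJOptimal.eq_sum (h : LJOptimal J Sbar S lam) : S = ∑ j ∈ J, lam j • Sbar j := by
  obtain ⟨⟨hS, hD, h1, h0⟩, hmin⟩ := h
  set T := ∑ j ∈ J, lam j • Sbar j with hT
  have hTpd : T.PosDef := posDef_of_posSemidef_sub hS hD
  have htr := hmin T lam ⟨hTpd, by rw [sub_self]; exact PosSemidef.zero, h1, h0⟩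
  -- This is `2 T⁻¹ - T⁻¹ S T⁻¹ ⪯ S⁻¹`, a completed square. Since `T` is feasible with the same
  -- weights, optimality of `S` forces the positive semidefinite gap to have trace zero.
  have hgap (x : Fin n → ℝ) :
      x ⬝ᵥ (T⁻¹ + T⁻¹ * (T - S) * T⁻¹) *ᵥ x ≤ x ⬝ᵥ S⁻¹ *ᵥ x := by
    have e := dotProduct_congr_mulVec T⁻¹ (T - S) x
    have hT' : T⁻¹ᵀ = T⁻¹ := by simpa using hTpd.inv.isHermitian.eq
    rw [hT', sub_mulVec, dotProduct_sub, mulVec_inv_mulVec hTpd] at e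
    have h2 := two_mul_dotProduct_le hS (T⁻¹ *ᵥ x) x
    rw [add_mulVec, dotProduct_add, e, dotProduct_comm x]
    linarith
  have htr2 := trace_le_of_form_le hgap
  have hpsd : (T⁻¹ * (T - S) * T⁻¹).PosSemidef := by
    have := hD.mul_mul_conjTranspose_same T⁻¹
    rwa [hTpd.inv.isHermitian.eq] at this
  rw [trace_add] at htr2
  have hz := hpsd.trace_eq_zero_iff.1 (le_antisymm (by linarith) hpsd.trace_nonneg)
  have hu := (isUnit_iff_isUnit_det _).1 hTpd.isUnit
  have : T * (T⁻¹ * (T - S) * T⁻¹) * T = T - S := by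
    rw [Matrix.mul_assoc, Matrix.mul_assoc, Matrix.nonsing_inv_mul _ hu, Matrix.mul_one,
      ← Matrix.mul_assoc, Matrix.mul_nonsing_inv _ hu, Matrix.one_mul]
  rw [hz, Matrix.mul_zero, Matrix.zero_mul] at this
  exact (sub_eq_zero.1 this.symm).symm

/-- First-order optimality of the outer Löwner–John problem in the direction of a vertex. -/
theorem LJOptimal.trace_mul_mul_le (h : LJOptimal J Sbar S lam) {j : V} (hj : j ∈ J)
    (hSj : (Sbar j).PosDef) : (S⁻¹ * Sbar j * S⁻¹).trace ≤ S⁻¹.trace := by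
  classical
  obtain ⟨⟨hS, hD, h1, h0⟩, hmin⟩ := h
  have huS := (isUnit_iff_isUnit_det _).1 hS.isUnit
  -- The segment towards the vertex `Sbar j` stays feasible. The resolvent identity makes the change
  -- of `Tr (S⁻¹)` an explicit multiple of `ε`, so that dividing by `ε` and letting `ε → 0` replaces
  -- a differentiation.
  let f : ℝ → Matrix (Fin n) (Fin n) ℝ := fun ε => S + ε • (Sbar j - S)
  have hf (ε : ℝ) : f ε = (1 - ε) • S + ε • Sbar j := by
    simp only [f, smul_sub, sub_smul, one_smul]; abel
  have hpos (ε : ℝ) (hε : ε ∈ Set.Ioo (0 : ℝ) 1) :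
      0 ≤ ((f ε)⁻¹ * (S - Sbar j) * S⁻¹).trace := by
    have hfpd : (f ε).PosDef := by
      rw [hf]
      exact (hS.smul (sub_pos.2 hε.2)).add (hSj.smul hε.1)
    have hfeas : LJFeasible J Sbar (f ε)
        (fun i => (1 - ε) * lam i + if i = j then ε else 0) := by
      refine ⟨hfpd, ?_, ?_, fun i hi => ?_⟩
      · have : ∑ i ∈ J, ((1 - ε) * lam i + if i = j then ε else 0) • Sbar i - f ε =
            (1 - ε) • (∑ i ∈ J, lam i • Sbar i - S) := by
          simp only [add_smul, Finset.sum_add_distrib, ite_smul, zero_smul, mul_smul,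
            ← Finset.smul_sum, Finset.sum_ite_eq', hj, if_true, hf, smul_sub]
          abel
        rw [this]
        exact hD.smul (sub_nonneg.2 hε.2.le)
      · simp only [Finset.sum_add_distrib, ← Finset.mul_sum, Finset.sum_ite_eq', hj, if_true]
        nlinarith [hε.1, hε.2]
      · have := mul_nonneg (sub_nonneg.2 hε.2.le) (h0 i hi)
        have h2 := hε.1.le
        dsimp only
        split_ifs <;> linarith
    have hle := hmin _ _ hfeas
    have huf := (isUnit_iff_isUnit_det _).1 hfpd.isUnit
    have hres : (f ε)⁻¹ - S⁻¹ = ε • ((f ε)⁻¹ * (S - Sbar j) * S⁻¹) := by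
      have e : ε • (S - Sbar j) = S - f ε := by simp only [f, smul_sub]; abel
      rw [← Matrix.smul_mul, ← Matrix.mul_smul, e, Matrix.mul_sub, Matrix.sub_mul,
        Matrix.nonsing_inv_mul _ huf, Matrix.mul_assoc, Matrix.mul_nonsing_inv _ huS,
        Matrix.mul_one, Matrix.one_mul]
    have htr := congrArg trace hres
    rw [trace_sub, trace_smul, smul_eq_mul] at htr
    have : 0 ≤ ε * ((f ε)⁻¹ * (S - Sbar j) * S⁻¹).trace := by linarith
    exact nonneg_of_mul_nonneg_right this hε.1
  have hf0 : f 0 = S := by simp [f]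
  have hcont : ContinuousAt (fun ε => ((f ε)⁻¹ * (S - Sbar j) * S⁻¹).trace) 0 := by
    have hfc : ContinuousAt f 0 := by fun_prop
    have hdet : S.det ≠ 0 := huS.ne_zero
    have hinv : ContinuousAt (fun ε => (f ε)⁻¹) 0 := by
      refine ContinuousAt.comp (g := Inv.inv) ?_ hfc
      rw [hf0]
      refine continuousAt_matrix_inv S ?_
      rw [Ring.inverse_eq_inv']
      exact continuousAt_inv₀ hdet
    have hg : Continuous fun X : Matrix (Fin n) (Fin n) ℝ => (X * (S - Sbar j) * S⁻¹).trace := by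
      fun_prop
    exact ContinuousAt.comp (g := fun X : Matrix (Fin n) (Fin n) ℝ =>
      (X * (S - Sbar j) * S⁻¹).trace) hg.continuousAt hinv
  have hlim : 0 ≤ ((f 0)⁻¹ * (S - Sbar j) * S⁻¹).trace :=
    ge_of_tendsto (hcont.tendsto.mono_left (nhdsWithin_le_nhds (s := Set.Ioi 0)))
      (eventually_of_mem (Ioo_mem_nhdsGT one_pos) hpos)
  rw [hf0, Matrix.mul_sub, Matrix.sub_mul, Matrix.nonsing_inv_mul _ huS, Matrix.one_mul,
    trace_sub] at hlim
  linarith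

/-- The fused covariance is small wherever the covariance of one of the fused nodes is. -/
theorem LJOptimal.sq_form_inv_le (h : LJOptimal J Sbar S lam) {j : V} (hj : j ∈ J)
    {P : Matrix (Fin n) (Fin n) ℝ} (hP : P.PosDef) (hSj : Sbar j = P⁻¹) (w : Fin n → ℝ) :
    (w ⬝ᵥ S⁻¹ *ᵥ w) ^ 2 ≤ (w ⬝ᵥ w) * (S⁻¹.trace * (w ⬝ᵥ P *ᵥ w)) := by
  have hS := h.1.1
  have htr := h.trace_mul_mul_le hj (hSj ▸ hP.inv)
  rw [hSj] at htr
  have hSt : S⁻¹ᵀ = S⁻¹ := by simpa using hS.inv.isHermitian.eq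
  have hpsd : (S⁻¹ * P⁻¹ * S⁻¹).PosSemidef := by
    have := hP.inv.posSemidef.mul_mul_conjTranspose_same S⁻¹
    rwa [hS.inv.isHermitian.eq] at this
  set z := S⁻¹ *ᵥ w with hz
  have h1 : (S⁻¹ *ᵥ z) ⬝ᵥ P⁻¹ *ᵥ (S⁻¹ *ᵥ z) ≤ S⁻¹.trace * (z ⬝ᵥ z) := by
    have e := dotProduct_congr_mulVec S⁻¹ P⁻¹ z
    rw [hSt] at e
    rw [← e]
    exact (form_le_trace_mul hpsd z).trans
      (mul_le_mul_of_nonneg_right htr (dotProduct_self_nonneg z))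
  have h2 : z ⬝ᵥ z = w ⬝ᵥ S⁻¹ *ᵥ z := by
    rw [dotProduct_mulVec_symm hS.inv.isHermitian w z, ← hz]
  have h3 := sq_dotProduct_le_form_mul hP w (S⁻¹ *ᵥ z)
  rw [← h2] at h3
  have hwP := posSemidef_nonneg hP.posSemidef w
  -- `h3` bounds `(z ⬝ᵥ z) ^ 2` and `h1` brings out a factor `z ⬝ᵥ z`, which cancels.
  have h4 : z ⬝ᵥ z ≤ S⁻¹.trace * (w ⬝ᵥ P *ᵥ w) := by
    rcases (dotProduct_self_nonneg z).eq_or_lt with h0 | h0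
    · rw [← h0]
      exact mul_nonneg hS.inv.posSemidef.trace_nonneg hwP
    · have := h3.trans (mul_le_mul_of_nonneg_left h1 hwP)
      refine le_of_mul_le_mul_right ?_ h0
      linarith
  exact (sq_dotProduct_le w z).trans (mul_le_mul_of_nonneg_left h4 (dotProduct_self_nonneg w))

/-- The fused covariance has at most the trace of each of the fused covariances. -/
theorem LJOptimal.trace_inv_le (h : LJOptimal J Sbar S lam) {j : V} (hj : j ∈ J)
    {P : Matrix (Fin n) (Fin n) ℝ} (hP : P.PosDef) (hSj : Sbar j = P⁻¹) :
    S⁻¹.trace ≤ P.trace := by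
  classical
  have hf : LJFeasible J Sbar (Sbar j) (fun i => if i = j then 1 else 0) := by
    refine ⟨hSj ▸ hP.inv, ?_, ?_, fun i _ => by dsimp only; split_ifs <;> norm_num⟩
    · simp only [ite_smul, one_smul, zero_smul, Finset.sum_ite_eq', hj, if_true, sub_self]
      exact PosSemidef.zero
    · simp [hj]
  have := h.2 _ _ hf
  rwa [hSj, posDef_inv_inv hP] at this

end OuterLJ

/-! ### Spreading of information over jointly connected graphs. -/

section Spreading

variable {V : Type*} [Fintype V]

/-- A set of nodes that grows along the edges of a jointly strongly connected sequence of graphs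
covers all nodes after finitely many windows. -/
theorem spread_eq_univ {hear : ℕ → V → V → Prop} {t : ℕ}
    (hspread : ∀ (s : ℕ) (F : Set V), F.Nonempty → F ≠ Set.univ →
      ∃ s', s ≤ s' ∧ s' ≤ s + t ∧ ∃ a ∉ F, ∃ b ∈ F, hear s' a b)
    {s : ℕ} {F : ℕ → Set V} (hmono : Monotone F)
    (hF : ∀ l a b, hear (s + l) a b → b ∈ F l → a ∈ F (l + 1)) (h0 : (F 0).Nonempty) :
    F (Fintype.card V * (t + 1)) = Set.univ := by
  have key (q : ℕ) : F (q * (t + 1)) = Set.univ ∨ q + 1 ≤ (F (q * (t + 1))).ncard := by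
    induction q with
    | zero =>
      right
      rw [Nat.zero_mul]
      exact (Set.ncard_pos (Set.toFinite _)).2 h0
    | succ q ih =>
      by_cases hu : F (q * (t + 1)) = Set.univ
      · left
        exact Set.univ_subset_iff.1 (hu ▸ hmono (Nat.mul_le_mul_right _ q.le_succ))
      · right
        have hc := ih.resolve_left hu
        -- Each window of `t + 1` instants adds at least one node.
        obtain ⟨s', hs1, hs2, a, ha, b, hb, hab⟩ := hspread (s + q * (t + 1)) _
          (h0.mono (hmono (Nat.zero_le _))) hu
        obtain ⟨l, rfl⟩ := Nat.exists_eq_add_of_le ((Nat.le_add_right s _).trans hs1)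
        have hl1 : q * (t + 1) ≤ l := by omega
        have hl2 : l + 1 ≤ (q + 1) * (t + 1) := by rw [Nat.add_mul]; omega
        have ha' := hmono hl2 (hF l a b hab (hmono hl1 hb))
        have hss : F (q * (t + 1)) ⊂ F ((q + 1) * (t + 1)) :=
          ⟨hmono (Nat.mul_le_mul_right _ q.le_succ), fun h => ha (h ha')⟩
        exact Nat.succ_le_of_lt (hc.trans_lt (Set.ncard_lt_ncard hss (Set.toFinite _)))
  refine (key (Fintype.card V)).resolve_right fun h => ?_
  have := (Set.ncard_le_ncard (Set.subset_univ (F (Fintype.card V * (t + 1)))))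
  rw [Set.ncard_univ, Nat.card_eq_fintype_card] at this
  omega

/-- Functionals that are known somewhere spread over a jointly strongly connected sequence of
graphs. Together with observability, after sufficiently many instants every node knows
every functional. -/
theorem exists_forall_known_eq_top {E : Type*} [AddCommGroup E] [Module ℝ E]
    [FiniteDimensional ℝ E] (B : Module.End ℝ E) (D : V → Set E) (n t : ℕ)
    (hobs : Submodule.span ℝ {x | ∃ q ≤ n, ∃ i, ∃ h ∈ D i, x = (B ^ q) h} = ⊤) :
    ∃ K : ℕ, ∀ (hear : ℕ → V → V → Prop) (W : ℕ → V → Submodule ℝ E),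
      (∀ (s : ℕ) (F : Set V), F.Nonempty → F ≠ Set.univ →
        ∃ s', s ≤ s' ∧ s' ≤ s + t ∧ ∃ a ∉ F, ∃ b ∈ F, hear s' a b) →
      (∀ s i, hear s i i) →
      (∀ s < K, ∀ i j, hear s i j → ∀ w, B w ∈ W s j → w ∈ W (s + 1) i) →
      (∀ s i, ∀ h ∈ D i, h ∈ W (s + 1) i) →
      ∀ i, W K i = ⊤ := by
  -- `B` may be singular, so a measured functional need not be a value of `B ^ l`. From `m₀` on the
  -- ranges of the powers are constant, and preimages exist up to `ker (B ^ m₀)`.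
  obtain ⟨m₀, hm₀⟩ := IsArtinian.monotone_stabilizes B.iterateRange
  have hrange (m : ℕ) (x : E) : ∃ y, (B ^ (m + m₀)) y = (B ^ m₀) x := by
    have h1 := hm₀ (m + m₀) (Nat.le_add_left _ _)
    have h2 : LinearMap.range (B ^ m₀) = LinearMap.range (B ^ (m + m₀)) := h1
    have h3 : (B ^ m₀) x ∈ LinearMap.range (B ^ m₀) := ⟨x, rfl⟩
    rw [h2] at h3
    exact h3
  set r := Fintype.card V * (t + 1) with hr
  refine ⟨r + n + m₀ + 1, fun hear W hspread hself hstep hmeas i => ?_⟩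
  set K := r + n + m₀ + 1 with hK
  -- The zero functional is always known; pulling it back `l` times yields all of `ker (B ^ l)`.
  have hker (l : ℕ) : ∀ s, l ≤ s → s ≤ K → ∀ j, ∀ w, (B ^ l) w = 0 → w ∈ W s j := by
    induction l with
    | zero =>
      intro s _ _ j w hw
      rw [pow_zero, Module.End.one_apply] at hw
      rw [hw]
      exact zero_mem _
    | succ l ih =>
      intro s hs hsK j w hw
      obtain ⟨s, rfl⟩ : ∃ s', s = s' + 1 := ⟨s - 1, by omega⟩
      refine hstep s (by omega) j j (hself s j) w (ih s (by omega) (by omega) j _ ?_)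
      rw [← Module.End.mul_apply, ← pow_succ, hw]
  have hreach (s l : ℕ) (hl : r ≤ l) (hsl : s + l ≤ K) (j : V) (w : E)
      (hw : (B ^ l) w ∈ W s j) : w ∈ W (s + l) i := by
    let F : ℕ → Set V := fun l => {a | s + l ≤ K → ∀ w, (B ^ l) w ∈ W s j → w ∈ W (s + l) a}
    have hF : ∀ l a b, hear (s + l) a b → b ∈ F l → a ∈ F (l + 1) := by
      intro l a b hab hb hle w hw
      refine hstep (s + l) (by omega) a b hab w (hb (by omega) _ ?_)
      rwa [← Module.End.mul_apply, ← pow_succ]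
    have hmono : Monotone F := monotone_nat_of_le_succ fun l a ha => hF l a a (hself _ _) ha
    have h0 : (F 0).Nonempty := ⟨j, fun _ w hw => by simpa using hw⟩
    have hu := spread_eq_univ hspread hmono hF h0
    have hi : i ∈ F r := by rw [hr, hu]; trivial
    exact hmono hl hi hsl w hw
  have hD : ((W K i).map (B ^ (r + n + m₀))).comap (B ^ m₀) = ⊤ := by
    rw [← top_le_iff, ← hobs, Submodule.span_le]
    rintro _ ⟨q, hq, j, h, hh, rfl⟩
    -- A measurement taken at `m₀ + q + 1` and pulled back `r + (n - q)` times arrives at instant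
    -- `K` for every `q`. The travel time is at least `r`, enough to reach node `i`.
    obtain ⟨w, hw⟩ := hrange (r + (n - q)) h
    refine ⟨w, ?_, ?_⟩
    · have h1 : (B ^ (r + (n - q))) w - h ∈ W (m₀ + q + 1) j := by
        refine hker m₀ _ (by omega) (by omega) j _ ?_
        rw [map_sub, ← Module.End.mul_apply, ← pow_add, Nat.add_comm m₀, hw, sub_self]
      have h2 := add_mem h1 (hmeas (m₀ + q) j h hh)
      rw [sub_add_cancel] at h2
      have h3 := hreach _ _ (Nat.le_add_right _ _) (by omega) j w h2
      have e : m₀ + q + 1 + (r + (n - q)) = K := by omega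
      rwa [e] at h3
    · have e : r + n + m₀ = q + (r + (n - q) + m₀) := by omega
      rw [e, pow_add, Module.End.mul_apply, hw, ← Module.End.mul_apply, ← Module.End.mul_apply,
        ← pow_add, ← pow_add, Nat.add_comm]
  rw [eq_top_iff]
  intro x _
  have hx : (B ^ (r + n)) x ∈ ((W K i).map (B ^ (r + n + m₀))).comap (B ^ m₀) := by
    rw [hD]; trivial
  obtain ⟨x', hx', he⟩ := hx
  -- `x` and the known `x'` have the same image under `B ^ (K - 1)`, and that kernel is known by
  -- instant `K`.
  have hd : x - x' ∈ W K i := by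
    refine hker (r + n + m₀) K (by omega) le_rfl i _ ?_
    rw [map_sub, he, ← Module.End.mul_apply, ← pow_add, Nat.add_comm m₀, sub_self]
  simpa using add_mem hd hx'

end Spreading

/-- Transposed rows of the observability matrix are the vectors `(Aᵀ) ^ q H_iᵀ e_a`, so full column
rank means that they span. -/
theorem SensorNetwork.NetworkObservable.span_eq_top {V : Type*} [Fintype V] {n : ℕ}
    {M : SensorNetwork V n} (h : M.NetworkObservable) :
    Submodule.span ℝ {x | ∃ q ≤ n, ∃ i, ∃ r ∈ Set.range fun y => (M.H i)ᵀ *ᵥ y,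
      x = (Matrix.mulVecLin M.Aᵀ ^ q) r} = ⊤ := by
  rw [SensorNetwork.NetworkObservable, Observable, Matrix.rank_eq_finrank_span_row] at h
  have htop := Submodule.eq_top_of_finrank_eq (h.trans (Module.finrank_fin_fun ℝ).symm)
  rw [← top_le_iff, ← htop, Submodule.span_le]
  rintro _ ⟨⟨q, i, a⟩, rfl⟩
  refine Submodule.subset_span ⟨q, q.2.le, i, (M.H i)ᵀ *ᵥ Pi.single a 1, ⟨_, rfl⟩, ?_⟩
  have hpow : Matrix.mulVecLin M.Aᵀ ^ (q : ℕ) = Matrix.mulVecLin (M.Aᵀ ^ (q : ℕ)) :=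
    (map_pow (Matrix.toLinAlgEquiv' (R := ℝ) (n := Fin n)) M.Aᵀ (q : ℕ)).symm
  rw [hpow, mulVecLin_apply, ← transpose_pow, mulVec_transpose, mulVec_single_one]
  rfl

/-! ### Bounds for one step of the filter. -/

namespace SensorNetwork

variable {V : Type*} {n : ℕ} (M : SensorNetwork V n)

theorem predCov_posDef {P : Matrix (Fin n) (Fin n) ℝ} (hP : P.PosSemidef) :
    (M.predCov P).PosDef :=
  posDef_congr_add M.Q_posDef hP M.A

theorem U_posSemidef (i : V) : (M.U i).PosSemidef := by
  have := (M.R_posDef i).inv.posSemidef.conjTranspose_mul_mul_same (M.H i)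
  rwa [conjTranspose_eq_transpose_of_trivial] at this

theorem form_predCov (P : Matrix (Fin n) (Fin n) ℝ) (w : Fin n → ℝ) :
    w ⬝ᵥ M.predCov P *ᵥ w = (M.Aᵀ *ᵥ w) ⬝ᵥ P *ᵥ (M.Aᵀ *ᵥ w) + w ⬝ᵥ M.Q *ᵥ w := by
  rw [predCov, add_mulVec, dotProduct_add, dotProduct_congr_mulVec]

end SensorNetwork

namespace Run

variable {V : Type*} [Fintype V] {n : ℕ} {M : SensorNetwork V n} {link : ℕ → Digraph V}
  {g : Trigger V} (ρ : Run M link g)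

theorem mem_J {k : ℕ} {i j : V} : j ∈ ρ.J k i ↔ j = i ∨ (ρ.graph k).Adj i j := by
  simp [J, hood]

theorem self_mem_J (k : ℕ) (i : V) : i ∈ ρ.J k i := ρ.mem_J.2 (Or.inl rfl)

theorem fusion' (k : ℕ) (i : V) : LJOptimal (ρ.J (k + 1) i)
    (fun j => (M.predCov (ρ.Phat k j))⁻¹) (ρ.Sstar (k + 1) i) (ρ.lam (k + 1) i) :=
  ρ.fusion k i

theorem Sstar_posDef (k : ℕ) (i : V) : (ρ.Sstar (k + 1) i).PosDef := (ρ.fusion k i).1.1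

theorem Y_posSemidef (k : ℕ) (i : V) : (ρ.Y k i).PosSemidef :=
  posSemidef_sum _ fun j _ => M.U_posSemidef j

theorem Phat_succ (k : ℕ) (i : V) :
    ρ.Phat (k + 1) i = (ρ.Sstar (k + 1) i + ρ.Y (k + 1) i)⁻¹ :=
  ρ.correction k i

theorem info_posDef (k : ℕ) (i : V) : (ρ.Sstar (k + 1) i + ρ.Y (k + 1) i).PosDef :=
  (ρ.Sstar_posDef k i).add_posSemidef (ρ.Y_posSemidef _ i)

theorem Phat_posDef (k : ℕ) (i : V) : (ρ.Phat k i).PosDef := by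
  cases k with
  | zero => exact ρ.Phat_zero i
  | succ k => rw [ρ.Phat_succ]; exact (ρ.info_posDef k i).inv

theorem Phat_succ_inv (k : ℕ) (i : V) :
    (ρ.Phat (k + 1) i)⁻¹ = ρ.Sstar (k + 1) i + ρ.Y (k + 1) i := by
  rw [ρ.Phat_succ, posDef_inv_inv (ρ.info_posDef k i)]

theorem predCov_posDef (k : ℕ) (i : V) : (M.predCov (ρ.Phat k i)).PosDef :=
  M.predCov_posDef (ρ.Phat_posDef k i).posSemidef

theorem form_Phat_succ_le (k : ℕ) (i : V) (w : Fin n → ℝ) :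
    w ⬝ᵥ ρ.Phat (k + 1) i *ᵥ w ≤ w ⬝ᵥ (ρ.Sstar (k + 1) i)⁻¹ *ᵥ w := by
  rw [ρ.Phat_succ]
  refine form_inv_anti (ρ.Sstar_posDef k i) (ρ.info_posDef k i) (fun x => ?_) w
  rw [add_mulVec, dotProduct_add]
  linarith [posSemidef_nonneg (ρ.Y_posSemidef (k + 1) i) x]

theorem form_U_le_form_Y {k : ℕ} {i j : V} (hj : j ∈ ρ.J k i) (x : Fin n → ℝ) :
    x ⬝ᵥ M.U j *ᵥ x ≤ x ⬝ᵥ ρ.Y k i *ᵥ x := by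
  have hY : x ⬝ᵥ ρ.Y k i *ᵥ x = ∑ l ∈ ρ.J k i, x ⬝ᵥ M.U l *ᵥ x := by
    simp [Y, sum_mulVec, dotProduct_sum]
  rw [hY]
  exact Finset.single_le_sum (f := fun l => x ⬝ᵥ M.U l *ᵥ x)
    (fun l _ => posSemidef_nonneg (M.U_posSemidef l) x) hj

theorem form_Phat_measured_le (k : ℕ) (i : V) (y : Fin (M.m i) → ℝ) :
    ((M.H i)ᵀ *ᵥ y) ⬝ᵥ ρ.Phat (k + 1) i *ᵥ ((M.H i)ᵀ *ᵥ y) ≤ y ⬝ᵥ M.R i *ᵥ y := by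
  rw [ρ.Phat_succ]
  refine form_inv_le_of_measured (ρ.info_posDef k i) (M.R_posDef i) (M.H i) (fun x => ?_) y
  rw [add_mulVec, dotProduct_add]
  have h1 := ρ.form_U_le_form_Y (ρ.self_mem_J (k + 1) i) x
  have h2 := posSemidef_nonneg (ρ.Sstar_posDef k i).posSemidef x
  rw [SensorNetwork.U] at h1
  linarith

/-- Node `i` always belongs to its own neighbourhood, so its own prediction is a competitor,
whatever it hears. -/
theorem trace_Sstar_inv_le (k : ℕ) (i : V) :
    (ρ.Sstar (k + 1) i)⁻¹.trace ≤
      (ρ.Phat k i).trace * (M.A * M.Aᵀ).trace + M.Q.trace := by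
  refine ((ρ.fusion' k i).trace_inv_le (ρ.self_mem_J _ i) (ρ.predCov_posDef k i) rfl).trans ?_
  rw [SensorNetwork.predCov, trace_add]
  linarith [trace_congr_le M.A (ρ.Phat_posDef k i).posSemidef]

theorem sq_form_Phat_succ_le {k : ℕ} {i j : V} (hj : j ∈ ρ.J (k + 1) i) (w : Fin n → ℝ) :
    (w ⬝ᵥ ρ.Phat (k + 1) i *ᵥ w) ^ 2 ≤
      (w ⬝ᵥ w) * (((ρ.Phat k i).trace * (M.A * M.Aᵀ).trace + M.Q.trace) *
        ((M.Aᵀ *ᵥ w) ⬝ᵥ ρ.Phat k j *ᵥ (M.Aᵀ *ᵥ w) + w ⬝ᵥ M.Q *ᵥ w)) := by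
  rw [← M.form_predCov]
  have h1 := (ρ.fusion' k i).sq_form_inv_le hj (ρ.predCov_posDef k j) rfl w
  have h2 : (w ⬝ᵥ ρ.Phat (k + 1) i *ᵥ w) ^ 2 ≤ (w ⬝ᵥ (ρ.Sstar (k + 1) i)⁻¹ *ᵥ w) ^ 2 :=
    pow_le_pow_left₀ (posSemidef_nonneg (ρ.Phat_posDef _ i).posSemidef w)
      (ρ.form_Phat_succ_le k i w) 2
  refine h2.trans (h1.trans (mul_le_mul_of_nonneg_left ?_ (dotProduct_self_nonneg w)))
  exact mul_le_mul_of_nonneg_right (ρ.trace_Sstar_inv_le k i)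
    (posSemidef_nonneg (ρ.predCov_posDef k j).posSemidef w)

/-! ### Boundedness of the covariances. -/

/-- If the covariances are unbounded, then there are windows of any length at the end of which
a covariance reaches an arbitrarily large record value. -/
theorem exists_record (h : ∀ p, ∃ k i, p < (ρ.Phat k i).trace) (K : ℕ) (p : ℝ) :
    ∃ μ, p ≤ μ ∧ ∃ b : ℕ, (∀ s < K, ∀ j, (ρ.Phat (b + s) j).trace ≤ μ) ∧
      ∃ i, μ < (ρ.Phat (b + K) i).trace := by
  classical
  have h0 (k : ℕ) (i : V) : 0 ≤ (ρ.Phat k i).trace := (ρ.Phat_posDef k i).posSemidef.trace_nonneg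
  -- `c` dominates every trace up to instant `K`, so `μ` is first exceeded after `K`, which leaves
  -- room for the window.
  set c := ∑ k ∈ Finset.range (K + 1), ∑ i, (ρ.Phat k i).trace with hc
  set μ := |p| + c with hμ
  have hc0 : 0 ≤ c := Finset.sum_nonneg fun k _ => Finset.sum_nonneg fun i _ => h0 k i
  have hex := h μ
  have hspec := Nat.find_spec hex
  set k := Nat.find hex with hk
  have hlt : K < k := by
    by_contra hle
    obtain ⟨i, hi⟩ := hspec
    have h1 : (ρ.Phat k i).trace ≤ ∑ j, (ρ.Phat k j).trace :=
      Finset.single_le_sum (f := fun j => (ρ.Phat k j).trace) (fun j _ => h0 k j)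
        (Finset.mem_univ i)
    have h2 : ∑ j, (ρ.Phat k j).trace ≤ c :=
      Finset.single_le_sum (f := fun k => ∑ j, (ρ.Phat k j).trace)
        (fun k _ => Finset.sum_nonneg fun j _ => h0 k j) (Finset.mem_range.2 (by omega))
    linarith [abs_nonneg p]
  refine ⟨μ, by linarith [le_abs_self p], k - K, fun s hs j => ?_, ?_⟩
  · have := Nat.find_min hex (m := k - K + s) (by omega)
    exact not_lt.1 fun hj => this ⟨j, hj⟩
  · rwa [Nat.sub_add_cancel hlt.le]

/-- The functionals whose variance at node `i` is negligible compared with `μ` along the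
instants `τ`. -/
def known (f : Filter ℕ) (μ : ℕ → ℝ) (τ : ℕ → ℕ) (i : V) : Submodule ℝ (Fin n → ℝ) where
  carrier := {w | Tendsto (fun m => (w ⬝ᵥ ρ.Phat (τ m) i *ᵥ w) / |μ m|) f (𝓝 0)}
  zero_mem' := by simpa using tendsto_const_nhds
  add_mem' := by
    intro v w hv hw
    -- By the parallelogram law, the form at `v + w` is at most twice the sum of the forms at `v`
    -- and `w`.
    have hsum : Tendsto (fun m => 2 * ((v ⬝ᵥ ρ.Phat (τ m) i *ᵥ v) / |μ m|) +
        2 * ((w ⬝ᵥ ρ.Phat (τ m) i *ᵥ w) / |μ m|)) f (𝓝 0) := by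
      simpa using (hv.const_mul 2).add (hw.const_mul 2)
    refine squeeze_zero (fun m => ?_) (fun m => ?_) hsum
    · exact div_nonneg (posSemidef_nonneg (ρ.Phat_posDef _ i).posSemidef _) (abs_nonneg _)
    · have h := posSemidef_nonneg (ρ.Phat_posDef (τ m) i).posSemidef (v - w)
      rw [← mul_div_assoc, ← mul_div_assoc, ← add_div]
      refine div_le_div_of_nonneg_right ?_ (abs_nonneg _)
      simp only [mulVec_sub, dotProduct_sub, sub_dotProduct] at h
      simp only [mulVec_add, dotProduct_add, add_dotProduct]
      linarith
  smul_mem' := by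
    intro c w hw
    have := hw.const_mul (c * c)
    rw [mul_zero] at this
    refine this.congr fun m => ?_
    simp only [smul_dotProduct, mulVec_smul, dotProduct_smul, smul_eq_mul]
    ring

theorem mem_known {f : Filter ℕ} {μ : ℕ → ℝ} {τ : ℕ → ℕ} {i : V} {w : Fin n → ℝ} :
    w ∈ ρ.known f μ τ i ↔
      Tendsto (fun m => (w ⬝ᵥ ρ.Phat (τ m) i *ᵥ w) / |μ m|) f (𝓝 0) :=
  Iff.rfl

/-- The squared variance after fusion is at most a constant times `μ` times a quantity that is
`o(μ)`. Dividing by `μ ^ 2` and taking the root gives the limit. -/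
theorem mem_known_succ {f : Filter ℕ} {μ : ℕ → ℝ} {τ : ℕ → ℕ} {i j : V}
    (hμ : Tendsto μ f atTop) (htr : ∀ᶠ m in f, (ρ.Phat (τ m) i).trace ≤ μ m)
    (hj : ∀ᶠ m in f, j ∈ ρ.J (τ m + 1) i) {w : Fin n → ℝ}
    (hw : M.Aᵀ *ᵥ w ∈ ρ.known f μ τ j) : w ∈ ρ.known f μ (fun m => τ m + 1) i := by
  rw [mem_known] at hw ⊢
  set α := (M.A * M.Aᵀ).trace
  have hα : 0 ≤ α := by
    have := (posSemidef_self_mul_conjTranspose M.A).trace_nonneg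
    rwa [conjTranspose_eq_transpose_of_trivial] at this
  have hq : 0 ≤ M.Q.trace := M.Q_posDef.posSemidef.trace_nonneg
  have hμ' : Tendsto (fun m => |μ m|) f atTop := tendsto_abs_atTop_atTop.comp hμ
  have hQ : Tendsto (fun m => (w ⬝ᵥ M.Q *ᵥ w) / |μ m|) f (𝓝 0) := hμ'.const_div_atTop _
  have hb := (hw.add hQ).const_mul ((w ⬝ᵥ w) * (α + M.Q.trace))
  rw [add_zero, mul_zero] at hb
  have hsq : Tendsto (fun m => ((w ⬝ᵥ ρ.Phat (τ m + 1) i *ᵥ w) / |μ m|) ^ 2) f (𝓝 0) := by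
    refine squeeze_zero' (Eventually.of_forall fun m => sq_nonneg _) ?_ hb
    filter_upwards [htr, hj, hμ.eventually_ge_atTop 1] with m h1 h2 h3
    have h4 := ρ.sq_form_Phat_succ_le h2 w
    have hpos : 0 < μ m := by linarith
    rw [abs_of_pos hpos, div_pow, ← add_div, div_le_iff₀ (by positivity)]
    refine h4.trans ?_
    have h5 : (ρ.Phat (τ m) i).trace * α + M.Q.trace ≤ (α + M.Q.trace) * μ m := by
      nlinarith
    have h6 : 0 ≤ (M.Aᵀ *ᵥ w) ⬝ᵥ ρ.Phat (τ m) j *ᵥ (M.Aᵀ *ᵥ w) + w ⬝ᵥ M.Q *ᵥ w :=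
      add_nonneg (posSemidef_nonneg (ρ.Phat_posDef _ j).posSemidef _)
        (posSemidef_nonneg M.Q_posDef.posSemidef _)
    refine (mul_le_mul_of_nonneg_left (mul_le_mul_of_nonneg_right h5 h6)
      (dotProduct_self_nonneg w)).trans_eq ?_
    field_simp
  have hroot := (Real.continuous_sqrt.tendsto 0).comp hsq
  rw [Real.sqrt_zero] at hroot
  refine hroot.congr fun m => ?_
  exact Real.sqrt_sq (div_nonneg (posSemidef_nonneg (ρ.Phat_posDef _ i).posSemidef _)
    (abs_nonneg _))

theorem measured_mem_known {f : Filter ℕ} {μ : ℕ → ℝ} (τ : ℕ → ℕ) (i : V)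
    (hμ : Tendsto μ f atTop) (y : Fin (M.m i) → ℝ) :
    (M.H i)ᵀ *ᵥ y ∈ ρ.known f μ (fun m => τ m + 1) i := by
  have hμ' : Tendsto (fun m => |μ m|) f atTop := tendsto_abs_atTop_atTop.comp hμ
  refine squeeze_zero (fun m => ?_) (fun m => ?_) (hμ'.const_div_atTop (y ⬝ᵥ M.R i *ᵥ y))
  · exact div_nonneg (posSemidef_nonneg (ρ.Phat_posDef _ i).posSemidef _) (abs_nonneg _)
  · exact div_le_div_of_nonneg_right (ρ.form_Phat_measured_le _ i y) (abs_nonneg _)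

theorem tendsto_trace_of_known_eq_top {f : Filter ℕ} {μ : ℕ → ℝ} {τ : ℕ → ℕ} {i : V}
    (h : ρ.known f μ τ i = ⊤) :
    Tendsto (fun m => (ρ.Phat (τ m) i).trace / |μ m|) f (𝓝 0) := by
  have h1 (d : Fin n) : Pi.single d (1 : ℝ) ∈ ρ.known f μ τ i := h ▸ Submodule.mem_top
  have h2 := tendsto_finsetSum Finset.univ fun d _ => ρ.mem_known.1 (h1 d)
  rw [Finset.sum_const_zero] at h2
  refine h2.congr fun m => ?_
  rw [trace_eq_sum_form, Finset.sum_div]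

/-- Along an ultrafilter, the communication graphs of a jointly connected window have an edge
that enters a given set of informed nodes. -/
theorem exists_eventually_hears {t : ℕ} (hPJC : ∀ k, 1 ≤ k → IsPJC ρ.graph t k)
    (f : Ultrafilter ℕ) (b : ℕ → ℕ) (s : ℕ) {F : Set V} (hne : F.Nonempty)
    (hF : F ≠ Set.univ) :
    ∃ s', s ≤ s' ∧ s' ≤ s + t ∧ ∃ a ∉ F, ∃ c ∈ F, ∀ᶠ m in f, c ∈ ρ.J (b m + s' + 1) a := by
  obtain ⟨j, hj⟩ := hne
  obtain ⟨i, hi⟩ := (Set.ne_univ_iff_exists_notMem F).1 hF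
  have hpath (G : Digraph V) (h : Relation.ReflTransGen G.Adj i j) :
      ∃ a ∉ F, ∃ c ∈ F, G.Adj a c := by
    by_contra! hno
    have : ∀ x, Relation.ReflTransGen G.Adj i x → x ∉ F := by
      intro x hx
      induction hx with
      | refl => exact hi
      | tail _ hbc ih => exact fun hc => hno _ ih _ hc hbc
    exact this j h hj
  -- For each `m`, a path from outside `F` into `F` has an entering edge. There are finitely many
  -- triples (instant, listener, sender), so the ultrafilter selects one that serves for almost all
  -- `m`.
  have hall : ∀ᶠ m in f, ∃ x : Fin (t + 1) × V × V, x.2.1 ∉ F ∧ x.2.2 ∈ F ∧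
      x.2.2 ∈ ρ.J (b m + (s + x.1) + 1) x.2.1 := by
    refine Eventually.of_forall fun m => ?_
    obtain ⟨a, ha, c, hc, hac⟩ := hpath _ (hPJC (b m + s + 1) (by omega) i j)
    obtain ⟨x, hx⟩ := Digraph.iSup_adj.1 hac
    refine ⟨(x, a, c), ha, hc, ρ.mem_J.2 (Or.inr ?_)⟩
    have e : b m + (s + (x : ℕ)) + 1 = b m + s + 1 + x := by omega
    dsimp only
    rwa [e]
  obtain ⟨⟨x, a, c⟩, hx⟩ := Ultrafilter.eventually_exists_iff.1 hall
  obtain ⟨m, hm⟩ := hx.exists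
  exact ⟨s + x, Nat.le_add_right _ _, by have := x.2; omega, a, hm.1, c, hm.2.1,
    hx.mono fun m h => h.2.2⟩

/-- The covariances of the filter are bounded. -/
theorem exists_trace_Phat_le (hobs : M.NetworkObservable) {t : ℕ}
    (hPJC : ∀ k, 1 ≤ k → IsPJC ρ.graph t k) : ∃ p, ∀ k i, (ρ.Phat k i).trace ≤ p := by
  by_contra! hunb
  obtain ⟨K, hK⟩ := exists_forall_known_eq_top (Matrix.mulVecLin M.Aᵀ) _ n t hobs.span_eq_top
  choose μ hμ b hb i hi using fun m : ℕ => ρ.exists_record hunb K m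
  let f : Ultrafilter ℕ := hyperfilter ℕ
  have hμ' : Tendsto μ f atTop :=
    (tendsto_atTop_mono hμ tendsto_natCast_atTop_atTop).mono_left Nat.hyperfilter_le_atTop
  have htop := hK (fun s i j => ∀ᶠ m in f, j ∈ ρ.J (b m + s + 1) i)
    (fun s i => ρ.known f μ (fun m => b m + s) i)
    (fun s F hne hF => ρ.exists_eventually_hears hPJC f b s hne hF)
    (fun s i => Eventually.of_forall fun m => ρ.self_mem_J _ i)
    (fun s hs i j hij w hw => ρ.mem_known_succ hμ'
      (Eventually.of_forall fun m => hb m s hs i) hij hw)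
    (by
      rintro s i _ ⟨y, rfl⟩
      exact ρ.measured_mem_known (fun m => b m + s) i hμ' y)
  have hsmall : ∀ᶠ m in f, ∀ i, (ρ.Phat (b m + K) i).trace / |μ m| < 1 :=
    eventually_all.2 fun i => (ρ.tendsto_trace_of_known_eq_top (htop i)).eventually_lt_const one_pos
  obtain ⟨m, hm, hm1⟩ := (hsmall.and (hμ'.eventually_ge_atTop 1)).exists
  have h1 := hm (i m)
  have hpos : 0 < μ m := by linarith
  rw [abs_of_pos hpos, div_lt_one hpos] at h1
  exact lt_asymm h1 (hi m)

end Run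

/-! ### Contraction of the error and exponential decay. -/

theorem dotProduct_self_le_trace_inv_mul {ι : Type*} [Fintype ι] [DecidableEq ι]
    {S : Matrix ι ι ℝ} (hS : S.PosDef) (y : ι → ℝ) :
    y ⬝ᵥ y ≤ S⁻¹.trace * (y ⬝ᵥ S *ᵥ y) := by
  have h1 := sq_dotProduct_le_form_mul hS y y
  have h2 := form_le_trace_mul hS.inv.posSemidef y
  have h3 := posSemidef_nonneg hS.posSemidef y
  rcases (dotProduct_self_nonneg y).eq_or_lt with h0 | h0
  · rw [← h0]
    exact mul_nonneg hS.inv.posSemidef.trace_nonneg h3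
  · have := h1.trans (mul_le_mul_of_nonneg_left h2 h3)
    refine le_of_mul_le_mul_right ?_ h0
    linarith

/-- The prediction step contracts the information form of a bounded covariance. -/
theorem SensorNetwork.exists_predCov_contraction {V : Type*} {n : ℕ} (M : SensorNetwork V n)
    (p : ℝ) : ∃ β, 0 < β ∧ β < 1 ∧ ∀ P : Matrix (Fin n) (Fin n) ℝ, P.PosDef → P.trace ≤ p →
      ∀ x, (M.A *ᵥ x) ⬝ᵥ (M.predCov P)⁻¹ *ᵥ (M.A *ᵥ x) ≤ β * (x ⬝ᵥ P⁻¹ *ᵥ x) := by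
  set α := (M.A * M.Aᵀ).trace with hα
  have hAA : (M.A * M.Aᵀ).PosSemidef := by
    simpa using posSemidef_self_mul_conjTranspose M.A
  have hα0 : 0 ≤ α := hAA.trace_nonneg
  set q := M.Q⁻¹.trace with hq
  have hq0 : 0 ≤ q := M.Q_posDef.inv.posSemidef.trace_nonneg
  -- Chosen so that `A P Aᵀ ⪯ δ Q` whenever `P.trace ≤ p`; the summand `1` keeps `δ`, and so the
  -- factor `δ / (1 + δ)`, positive.
  set δ := |p| * α * q + 1 with hδ
  have hδ0 : 0 < δ := by positivity
  refine ⟨δ / (1 + δ), by positivity, (div_lt_one (by positivity)).2 (by linarith),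
    fun P hP hp x => ?_⟩
  have hpred := M.predCov_posDef hP.posSemidef
  set y := (M.predCov P)⁻¹ *ᵥ (M.A *ᵥ x) with hy
  have ha : (M.A *ᵥ x) ⬝ᵥ y = y ⬝ᵥ M.predCov P *ᵥ y := by
    rw [hy, mulVec_inv_mulVec hpred, dotProduct_comm]
  have hax : (M.A *ᵥ x) ⬝ᵥ y = x ⬝ᵥ M.Aᵀ *ᵥ y := by
    rw [dotProduct_mulVec x, vecMul_transpose]
  rw [M.form_predCov] at ha
  have h1 := form_le_trace_mul hP.posSemidef (M.Aᵀ *ᵥ y)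
  have h2 : (M.Aᵀ *ᵥ y) ⬝ᵥ (M.Aᵀ *ᵥ y) ≤ α * (y ⬝ᵥ y) := by
    have := form_le_trace_mul hAA y
    rwa [← mulVec_mulVec, dotProduct_mulVec, ← mulVec_transpose] at this
  have h3 := dotProduct_self_le_trace_inv_mul M.Q_posDef y
  have h4 : (M.Aᵀ *ᵥ y) ⬝ᵥ P *ᵥ (M.Aᵀ *ᵥ y) ≤ δ * (y ⬝ᵥ M.Q *ᵥ y) := by
    have hQ := posSemidef_nonneg M.Q_posDef.posSemidef y
    calc _ ≤ |p| * ((M.Aᵀ *ᵥ y) ⬝ᵥ (M.Aᵀ *ᵥ y)) := h1.trans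
          (mul_le_mul_of_nonneg_right (hp.trans (le_abs_self p)) (dotProduct_self_nonneg _))
      _ ≤ |p| * (α * (q * (y ⬝ᵥ M.Q *ᵥ y))) := by gcongr; exact h2.trans (by gcongr)
      _ ≤ δ * (y ⬝ᵥ M.Q *ᵥ y) := by rw [hδ]; linarith
  have h5 := two_mul_dotProduct_le_weighted hP.inv x (M.Aᵀ *ᵥ y)
    (show 0 < δ / (1 + δ) by positivity)
  rw [posDef_inv_inv hP] at h5
  -- By `h4`, `A P Aᵀ + Q ⪰ (1 + 1/δ) A P Aᵀ` on `y`. The last term of `h5` is therefore absorbed by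
  -- half of its left side.
  have h6 : (δ / (1 + δ))⁻¹ * ((M.Aᵀ *ᵥ y) ⬝ᵥ P *ᵥ (M.Aᵀ *ᵥ y)) ≤ (M.A *ᵥ x) ⬝ᵥ y := by
    rw [inv_div, div_mul_eq_mul_div, div_le_iff₀ hδ0, ha]
    linarith
  linarith

namespace Run

variable {V : Type*} [Fintype V] {n : ℕ} {M : SensorNetwork V n} {link : ℕ → Digraph V}
  {g : Trigger V} (ρ : Run M link g)

theorem Sstar_eq_sum (k : ℕ) (i : V) : ρ.Sstar (k + 1) i =
    ∑ j ∈ ρ.J (k + 1) i, ρ.lam (k + 1) i j • (M.predCov (ρ.Phat k j))⁻¹ :=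
  (ρ.fusion' k i).eq_sum

theorem lam_nonneg {k : ℕ} {i j : V} (hj : j ∈ ρ.J (k + 1) i) : 0 ≤ ρ.lam (k + 1) i j :=
  (ρ.fusion' k i).1.2.2.2 j hj

theorem sum_lam_le_one (k : ℕ) (i : V) : ∑ j ∈ ρ.J (k + 1) i, ρ.lam (k + 1) i j ≤ 1 :=
  (ρ.fusion' k i).1.2.2.1

theorem sum_lam_mul_le {k : ℕ} {i : V} {v : V → ℝ} {c : ℝ} (hc : 0 ≤ c) (hv : ∀ j, v j ≤ c) :
    ∑ j ∈ ρ.J (k + 1) i, ρ.lam (k + 1) i j * v j ≤ c := by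
  calc _ ≤ ∑ j ∈ ρ.J (k + 1) i, ρ.lam (k + 1) i j * c :=
        Finset.sum_le_sum fun j hj => mul_le_mul_of_nonneg_left (hv j) (ρ.lam_nonneg hj)
    _ = (∑ j ∈ ρ.J (k + 1) i, ρ.lam (k + 1) i j) * c := (Finset.sum_mul ..).symm
    _ ≤ 1 * c := mul_le_mul_of_nonneg_right (ρ.sum_lam_le_one k i) hc
    _ = c := one_mul c

/-- The noiseless error dynamics in information form. -/
theorem IsErrorTrajectory.info_mulVec {k₀ : ℕ} {η : ℕ → V → Fin n → ℝ}
    (h : ρ.IsErrorTrajectory k₀ η) {k : ℕ} (hk : k₀ ≤ k) (i : V) :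
    (ρ.Phat (k + 1) i)⁻¹ *ᵥ η (k + 1) i = ∑ j ∈ ρ.J (k + 1) i,
      ρ.lam (k + 1) i j • ((M.predCov (ρ.Phat k j))⁻¹ *ᵥ (M.A *ᵥ η k j)) := by
  obtain ⟨x, xhat, htraj, hη⟩ := h
  obtain ⟨hx, hxhat⟩ := htraj k hk
  have hy : ρ.y (k + 1) (fun j => M.H j *ᵥ x (k + 1)) i = ρ.Y (k + 1) i *ᵥ x (k + 1) := by
    simp only [y, Y, sum_mulVec, SensorNetwork.u, SensorNetwork.U, mulVec_mulVec]
  set e := ρ.xbarStar k (xhat k) i - x (k + 1) with he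
  have hηe : η (k + 1) i = e - ρ.Phat (k + 1) i *ᵥ (ρ.Y (k + 1) i *ᵥ e) := by
    rw [hη (k + 1) (by omega) i, hxhat i, nextEstimate, hy, he, ← mulVec_sub,
      ← neg_sub (ρ.xbarStar k (xhat k) i) (x (k + 1)), mulVec_neg, mulVec_neg]
    abel
  have hSe : (ρ.Phat (k + 1) i)⁻¹ *ᵥ η (k + 1) i = ρ.Sstar (k + 1) i *ᵥ e := by
    rw [hηe, mulVec_sub, inv_mulVec_mulVec (ρ.Phat_posDef _ i), ρ.Phat_succ_inv, add_mulVec,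
      add_sub_cancel_right]
  -- Writing `Sstar` as the weighted sum also distributes `x (k + 1) = A x k` over the neighbours,
  -- and only the errors remain.
  rw [hSe, he, mulVec_sub, xbarStar, mulVec_inv_mulVec (ρ.Sstar_posDef k i), ρ.Sstar_eq_sum,
    sum_mulVec, ← Finset.sum_sub_distrib]
  refine Finset.sum_congr rfl fun j _ => ?_
  rw [smul_mulVec, ← smul_sub, hx, ← mulVec_sub, ← mulVec_sub, hη k hk j]

theorem form_Phat_inv_nonneg (k : ℕ) (i : V) (x : Fin n → ℝ) :
    0 ≤ x ⬝ᵥ (ρ.Phat k i)⁻¹ *ᵥ x :=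
  posSemidef_nonneg (ρ.Phat_posDef k i).inv.posSemidef x

/-- The largest information form of the local errors contracts at every instant. -/
theorem IsErrorTrajectory.form_le {k₀ : ℕ} {η : ℕ → V → Fin n → ℝ}
    (h : ρ.IsErrorTrajectory k₀ η) {β : ℝ} (hβ : 0 < β)
    (hcontr : ∀ k j x, (M.A *ᵥ x) ⬝ᵥ (M.predCov (ρ.Phat k j))⁻¹ *ᵥ (M.A *ᵥ x) ≤
      β * (x ⬝ᵥ (ρ.Phat k j)⁻¹ *ᵥ x)) {k : ℕ} (hk : k₀ ≤ k) {c : ℝ} (hc : 0 ≤ c)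
    (hV : ∀ j, η k j ⬝ᵥ (ρ.Phat k j)⁻¹ *ᵥ η k j ≤ c) (i : V) :
    η (k + 1) i ⬝ᵥ (ρ.Phat (k + 1) i)⁻¹ *ᵥ η (k + 1) i ≤ β * c := by
  set w := η (k + 1) i with hw
  have h1 : w ⬝ᵥ (ρ.Phat (k + 1) i)⁻¹ *ᵥ w = ∑ j ∈ ρ.J (k + 1) i,
      ρ.lam (k + 1) i j * (w ⬝ᵥ (M.predCov (ρ.Phat k j))⁻¹ *ᵥ (M.A *ᵥ η k j)) := by
    rw [h.info_mulVec ρ hk i]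
    simp only [dotProduct_sum, dotProduct_smul, smul_eq_mul]
  have h2 : 2 * (w ⬝ᵥ (ρ.Phat (k + 1) i)⁻¹ *ᵥ w) ≤ ∑ j ∈ ρ.J (k + 1) i,
      (ρ.lam (k + 1) i j * (w ⬝ᵥ (M.predCov (ρ.Phat k j))⁻¹ *ᵥ w) +
       ρ.lam (k + 1) i j *
        ((M.A *ᵥ η k j) ⬝ᵥ (M.predCov (ρ.Phat k j))⁻¹ *ᵥ (M.A *ᵥ η k j))) := by
    rw [h1, Finset.mul_sum]
    refine Finset.sum_le_sum fun j hj => ?_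
    have hp := (ρ.predCov_posDef k j).inv
    have h3 := two_mul_dotProduct_le hp w
      ((M.predCov (ρ.Phat k j))⁻¹ *ᵥ (M.A *ᵥ η k j))
    rw [inv_mulVec_mulVec hp, dotProduct_comm (_ *ᵥ _) (M.A *ᵥ η k j)] at h3
    have := mul_le_mul_of_nonneg_left h3 (ρ.lam_nonneg hj)
    linarith
  rw [Finset.sum_add_distrib, ← form_sum_smul, ← ρ.Sstar_eq_sum] at h2
  -- The first sum in `h2` is thus at most half of its left side and is absorbed.
  have h4 : w ⬝ᵥ ρ.Sstar (k + 1) i *ᵥ w ≤ w ⬝ᵥ (ρ.Phat (k + 1) i)⁻¹ *ᵥ w := by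
    rw [ρ.Phat_succ_inv, add_mulVec, dotProduct_add]
    linarith [posSemidef_nonneg (ρ.Y_posSemidef (k + 1) i) w]
  have h5 := ρ.sum_lam_mul_le (k := k) (i := i) (mul_nonneg hβ.le hc)
    (fun j => (hcontr k j (η k j)).trans (mul_le_mul_of_nonneg_left (hV j) hβ.le))
  linarith

/-- The information matrices of the filter are bounded. -/
theorem exists_form_Phat_inv_le :
    ∃ c, 0 ≤ c ∧ ∀ k i x, x ⬝ᵥ (ρ.Phat k i)⁻¹ *ᵥ x ≤ c * (x ⬝ᵥ x) := by
  have h0 (i : V) : 0 ≤ (ρ.Phat 0 i)⁻¹.trace := (ρ.Phat_posDef 0 i).inv.posSemidef.trace_nonneg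
  have hU (i : V) : 0 ≤ (M.U i).trace := (M.U_posSemidef i).trace_nonneg
  have hQ : 0 ≤ M.Q⁻¹.trace := M.Q_posDef.inv.posSemidef.trace_nonneg
  have hs0 := Finset.sum_nonneg fun i (_ : i ∈ Finset.univ) => h0 i
  have hsU := Finset.sum_nonneg fun i (_ : i ∈ Finset.univ) => hU i
  refine ⟨∑ i, (ρ.Phat 0 i)⁻¹.trace + M.Q⁻¹.trace + ∑ i, (M.U i).trace,
    add_nonneg (add_nonneg hs0 hQ) hsU,
    fun k i x => ?_⟩
  have hxx := dotProduct_self_nonneg x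
  cases k with
  | zero =>
    refine (form_le_trace_mul (ρ.Phat_posDef 0 i).inv.posSemidef x).trans ?_
    refine mul_le_mul_of_nonneg_right ?_ hxx
    have := Finset.single_le_sum (fun i (_ : i ∈ Finset.univ) => h0 i) (Finset.mem_univ i)
    linarith
  | succ k =>
    have hS : x ⬝ᵥ ρ.Sstar (k + 1) i *ᵥ x ≤ M.Q⁻¹.trace * (x ⬝ᵥ x) := by
      rw [ρ.Sstar_eq_sum, form_sum_smul]
      refine ρ.sum_lam_mul_le (mul_nonneg hQ hxx) fun j => ?_
      refine (form_inv_anti M.Q_posDef (ρ.predCov_posDef k j) (fun z => ?_) x).trans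
        (form_le_trace_mul M.Q_posDef.inv.posSemidef x)
      rw [M.form_predCov]
      linarith [posSemidef_nonneg (ρ.Phat_posDef k j).posSemidef (M.Aᵀ *ᵥ z)]
    have hY : x ⬝ᵥ ρ.Y (k + 1) i *ᵥ x ≤ (∑ i, (M.U i).trace) * (x ⬝ᵥ x) := by
      rw [Y, sum_mulVec, dotProduct_sum, Finset.sum_mul]
      exact (Finset.sum_le_sum_of_subset_of_nonneg (Finset.subset_univ _)
        fun j _ _ => posSemidef_nonneg (M.U_posSemidef j) x).trans
        (Finset.sum_le_sum fun j _ => form_le_trace_mul (M.U_posSemidef j) x)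
    rw [ρ.Phat_succ_inv, add_mulVec, dotProduct_add, add_mul, add_mul]
    linarith [mul_nonneg hs0 hxx]

theorem dotProduct_self_le_norm_sq (v : V → Fin n → ℝ) (i : V) :
    v i ⬝ᵥ v i ≤ n * ‖v‖ ^ 2 := by
  have h (d : Fin n) : v i d * v i d ≤ ‖v‖ ^ 2 := by
    have h1 : |v i d| ≤ ‖v‖ := (norm_le_pi_norm (v i) d).trans (norm_le_pi_norm v i)
    rw [← pow_two, ← sq_abs]
    exact pow_le_pow_left₀ (abs_nonneg _) h1 2
  calc _ ≤ ∑ _d : Fin n, ‖v‖ ^ 2 := Finset.sum_le_sum fun d _ => h d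
    _ = n * ‖v‖ ^ 2 := by simp

theorem norm_sq_le_of_dotProduct_self_le {v : V → Fin n → ℝ} {c : ℝ} (hc : 0 ≤ c)
    (h : ∀ i, v i ⬝ᵥ v i ≤ c) : ‖v‖ ^ 2 ≤ c := by
  rw [← Real.le_sqrt (norm_nonneg v) hc]
  refine (pi_norm_le_iff_of_nonneg (Real.sqrt_nonneg c)).2 fun i =>
    (pi_norm_le_iff_of_nonneg (Real.sqrt_nonneg c)).2 fun d => Real.abs_le_sqrt ?_
  refine le_trans ?_ (h i)
  rw [pow_two]
  exact Finset.single_le_sum (f := fun d => v i d * v i d) (fun d _ => mul_self_nonneg _)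
    (Finset.mem_univ d)

/-- The noiseless estimation error decays exponentially, uniformly in the initial instant. -/
theorem exists_exponential_decay (hobs : M.NetworkObservable) {t : ℕ}
    (hPJC : ∀ k, 1 ≤ k → IsPJC ρ.graph t k) :
    ∃ C β : ℝ, 0 ≤ C ∧ 0 < β ∧ β < 1 ∧ ∀ k₀ η, ρ.IsErrorTrajectory k₀ η → ∀ d,
      ‖η (k₀ + d)‖ ^ 2 ≤ C * β ^ d * ‖η k₀‖ ^ 2 := by
  obtain ⟨p, hp⟩ := ρ.exists_trace_Phat_le hobs hPJC
  obtain ⟨β, hβ0, hβ1, hβ⟩ := M.exists_predCov_contraction p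
  obtain ⟨c, hc0, hc⟩ := ρ.exists_form_Phat_inv_le
  refine ⟨|p| * (c * n), β, by positivity, hβ0, hβ1, fun k₀ η h d => ?_⟩
  have hV : ∀ d i, η (k₀ + d) i ⬝ᵥ (ρ.Phat (k₀ + d) i)⁻¹ *ᵥ η (k₀ + d) i ≤
      β ^ d * (c * (n * ‖η k₀‖ ^ 2)) := by
    intro d
    induction d with
    | zero =>
      intro i
      rw [pow_zero, one_mul]
      exact (hc _ _ _).trans
        (mul_le_mul_of_nonneg_left (dotProduct_self_le_norm_sq (η k₀) i) hc0)
    | succ d ih =>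
      intro i
      have := h.form_le ρ hβ0 (fun k j => hβ _ (ρ.Phat_posDef k j) (hp k j))
        (Nat.le_add_right k₀ d) (by positivity) ih i
      rwa [← mul_assoc, ← pow_succ'] at this
  refine norm_sq_le_of_dotProduct_self_le (by positivity) fun i => ?_
  have h1 := dotProduct_self_le_trace_inv_mul (ρ.Phat_posDef (k₀ + d) i).inv (η (k₀ + d) i)
  rw [posDef_inv_inv (ρ.Phat_posDef _ i)] at h1
  calc _ ≤ |p| * (η (k₀ + d) i ⬝ᵥ (ρ.Phat (k₀ + d) i)⁻¹ *ᵥ η (k₀ + d) i) := h1.trans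
        (mul_le_mul_of_nonneg_right ((hp _ i).trans (le_abs_self p))
          (ρ.form_Phat_inv_nonneg _ i _))
    _ ≤ |p| * (β ^ d * (c * (n * ‖η k₀‖ ^ 2))) :=
        mul_le_mul_of_nonneg_left (hV d i) (abs_nonneg p)
    _ = _ := by ring

end Run

end ECODKF

/-- For a network-observable system, every run of the filter whose communication graphs are
periodically jointly connected with a finite period `t` at every instant `k ≥ 1` (the instants at
which messages are exchanged) is a globally asymptotically stable estimator. The links may vary
arbitrarily with time and the triggering functions are arbitrary. -/
theorem theorem3 {V : Type*} [Fintype V] {n : ℕ} (M : ECODKF.SensorNetwork V n)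
    (hobs : M.NetworkObservable)
    (link : ℕ → Digraph V) (g : ECODKF.Trigger V) (ρ : ECODKF.Run M link g)
    (t : ℕ) (hPJC : ∀ k, 1 ≤ k → ECODKF.IsPJC ρ.graph t k) :
    ρ.GloballyAsymptoticallyStable := by
  obtain ⟨C, β, hC, hβ0, hβ1, hdecay⟩ := ρ.exists_exponential_decay hobs hPJC
  have hlim (r : ℝ) : Tendsto (fun d : ℕ => C * β ^ d * r ^ 2) atTop (𝓝 0) := by
    simpa using ((tendsto_pow_atTop_nhds_zero_of_lt_one hβ0.le hβ1).const_mul C).mul_const (r ^ 2)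
  refine ⟨fun ε hε => ?_, fun r hr ε hε => ?_⟩
  · refine ⟨ε / (C + 1), by positivity, fun k₀ η h hδ k hk => ?_⟩
    obtain ⟨d, rfl⟩ := Nat.exists_eq_add_of_le hk
    refine lt_of_pow_lt_pow_left₀ 2 hε.le ((hdecay k₀ η h d).trans_lt ?_)
    rw [lt_div_iff₀ (by positivity)] at hδ
    have h1 : (‖η k₀‖ * (C + 1)) ^ 2 < ε ^ 2 :=
      pow_lt_pow_left₀ hδ (by positivity) two_ne_zero
    refine lt_of_le_of_lt ?_ h1
    -- The decay concerns squared norms; `C ≤ (C + 1) ^ 2` allows `δ = ε / (C + 1)` without square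
    -- roots.
    have h2 : C * β ^ d ≤ (C + 1) ^ 2 := by
      have h3 : C * β ^ d ≤ C * 1 :=
        mul_le_mul_of_nonneg_left (pow_le_one₀ hβ0.le hβ1.le) hC
      nlinarith
    rw [mul_pow, mul_comm (‖η k₀‖ ^ 2)]
    exact mul_le_mul_of_nonneg_right h2 (sq_nonneg _)
  · obtain ⟨T, hT⟩ := eventually_atTop.1
      ((hlim r).eventually_lt_const (show 0 < ε ^ 2 by positivity))
    refine ⟨T, fun k₀ η h hη k hk => ?_⟩
    obtain ⟨d, rfl⟩ := Nat.exists_eq_add_of_le ((Nat.le_add_right k₀ T).trans hk)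
    refine lt_of_pow_lt_pow_left₀ 2 hε.le ((hdecay k₀ η h d).trans_lt ?_)
    refine lt_of_le_of_lt ?_ (hT d (by omega))
    exact mul_le_mul_of_nonneg_left (pow_le_pow_left₀ (norm_nonneg _) hη.le 2) (by positivity)
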